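/- **Conventions.** A *partial group* $\mathcal P$ is a set $\mathcal P_1$ with sets $\mathcal P_n\subseteq \mathcal P_1^n$ of multipliable words ($n\ge 1$), products $\triangledown_n:\mathcal P_n\to\mathcal P_1$ ($\triangledown_1=\mathrm{id}$), a unit $1$ and an inversion, such that: deleting the first or last letter of a multipliable word of length at least $2$ gives a multipliable word; replacing a non-empty consecutive subword by its product keeps the word multipliable and does not change the product; inserting $1$ anywhere keeps a word multipliable; $\triangledown_2(1,x)=\triangledown_2(x,1)=x$; and, for $w^{-1}=(x_n^{-1},\dots,x_1^{-1})$, the concatenations of $w$ and $w^{-1}$ in both orders are multipliable for every multipliable $w=(x_1,\dots,x_n)$, with $\triangledown_2(x,x^{-1})=\triangledown_2(x^{-1},x)=1$. Maps of partial groups preserve multipliable words and products; an isomorphism is a bijective map whose inverse is also a map of partial groups. A group is a partial group in which all words are multipliable. Let $E(d)$ be the group of isometries of $\mathbb R^d$ and $M(d)$ its subgroup of orientation-preserving ones, acting on $\mathbb R^d$ from the right. For $\emptyset\ne F\subseteq\mathbb R^d$ let $G(F)=\{g\in E(d): Fg=F\}$ and $SG(F)=G(F)\cap M(d)$. Let $\mathcal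 P(F)$ (respectively $S\mathcal P(F)$) be the partial group whose multipliable words are the words $(\pi_1,\dots,\pi_n)$ in $E(d)$ (respectively $M(d)$), $n\ge1$, such that $K,K\pi_1,\dots,K\pi_1\cdots\pi_n$ are all connected components of $F$ for some connected component $K$ of $F$, with the usual product. For subgroups $A,B$ of a group, $A\cup B$ is the partial group with multipliable words $A^n\cup B^n$ and the usual product, and $A\vee_{A\cap B}B$ is the pushout of the inclusions of $A\cap B$ into $A$ and $B$ in the category of partial groups. For a partial group $\mathcal H$, the normalizer $N(\mathcal H)$ is the group of all $g\in\mathcal H_1$ such that inserting $g,g^{-1}$ or $g^{-1},g$ between two consecutive letters of a multipliable word always gives a multipliable word; it acts by $\eta^g=\triangledown_3(g^{-1},\eta,g)$. A *factor set* for $(\mathcal H,G)$, $G$ a group, consists of maps $\leftharpoonup:\mathcal H_1\times G\to\mathcal H_1$ and $\sigma:G\times G\to N(\mathcal H)$ such that $\eta\leftharpoonup1=\eta$; $\sigma(1,a)=\sigma(a,1)=1$; each $\eta\mapsto\eta\leftharpoonup a$ is a map of partial groups; $(\eta\leftharpoonup a)\leftharpoonup b=(\eta\leftharpoonup ab)^{\sigma(a,b)}$;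 and $\sigma(a,bc)\sigma(b,c)=\sigma(ab,c)(\sigma(a,b)\leftharpoonup c)$. The partial group $G\ltimes_{\leftharpoonup,\sigma}\mathcal H$ has underlying set $G\times\mathcal H_1$; a word $\boldsymbol\alpha=((c_i,\eta_i))_{1\le i\le n}$ is multipliable iff $A(\boldsymbol\alpha)=(\rho_1,\dots,\rho_n)$ is multipliable in $\mathcal H$, where $\rho_i=(\cdots(\eta_i\leftharpoonup c_{i+1})\cdots)\leftharpoonup c_n$; and its product is $(c_1\cdots c_n,\triangledown(\sigma(c_1,\dots,c_n),\rho_1,\dots,\rho_n))$ with $\sigma(c_1,\dots,c_n)=\sigma(c_1,c_2\cdots c_n)\sigma(c_2,c_3\cdots c_n)\cdots\sigma(c_{n-1},c_n)$. It is written $G\ltimes\mathcal H$ if $\sigma\equiv1$. **Theorem.** Let $F\subseteq\mathbb R^d$ have exactly two connected components $F_+\neq F_-$, and let $a\in E(d)$ satisfy $F_+a=F_-$ and $F_-a=F_+$. Let $C_2=\{1,c\}$. Then $$\mathcal P(F)\cong C_2\ltimes_{\leftharpoonup,\sigma}\bigl(G(F_+)\vee_{G(F_+)\cap G(F_-)}G(F_-)\bigr)$$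 for some factor set $(\leftharpoonup,\sigma)$. More precisely, $\mathcal H:=G(F_+)\cup G(F_-)$ with the inclusions of $G(F_\pm)$ is a pushout $G(F_+)\vee_{G(F_+)\cap G(F_-)}G(F_-)$; there is a factor set for $(\mathcal H,C_2)$ with $\eta\leftharpoonup c=a^{-1}\eta a$ and $\sigma(c,c)=a^2$; and $\psi(c^\iota,\eta)=a^\iota\eta$ ($\iota\in\{0,1\}$, $\eta\in\mathcal H_1$) defines an isomorphism of partial groups $\psi:C_2\ltimes_{\leftharpoonup,\sigma}\mathcal H\to\mathcal P(F)$. In particular, if $a^2=1$, then $\mathcal P(F)\cong C_2\ltimes\mathcal H$, where $c$ acts by $\eta^c=a^{-1}\eta a$. If $a\in M(d)$, all these statements also hold with $\mathcal P(F)$ and $G(F_\pm)$ replaced by $S\mathcal P(F)$ and $SG(F_\pm)$. -/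

import Mathlib

open CategoryTheory
open scoped Pointwise RightActions

universe u v

/-! ## Partial groups -/

/-- A set `α` (`= 𝒫₁`) with a family of non-empty "multipliable" words (the words of length `n` in
`dom` form `𝒫ₙ`) and multi-products `∇ₙ`, with `∇₁ = id`. -/
structure PartialSystem (α : Type u) where
  dom : Set (List α)
  prod : ∀ w : List α, w ∈ dom → α
  ne_nil : ∀ w ∈ dom, w ≠ []
  singleton_mem : ∀ x, [x] ∈ dom
  prod_singleton : ∀ x, prod [x] (singleton_mem x) = x

namespace PartialSystem

/-- `w` is multipliable and `∇ w = x`. -/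
def IsProd {α : Type u} (P : PartialSystem α) (w : List α) (x : α) : Prop :=
  ∃ h : w ∈ P.dom, P.prod w h = x

/-- Maps of partial groups: `φⁿ(𝒬ₙ) ⊆ 𝒫ₙ` and `∇ (φⁿ w) = φ (∇ w)`. -/
structure Hom {α : Type u} {β : Type v} (Q : PartialSystem α) (P : PartialSystem β) where
  toFun : α → β
  map_isProd : ∀ w x, Q.IsProd w x → P.IsProd (w.map toFun) (toFun x)

/-- Isomorphisms: a bijection such that both it and its inverse are maps of partial groups. -/
structure Iso {α : Type u} {β : Type v} (Q : PartialSystem α) (P : PartialSystem β) where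
  toEquiv : α ≃ β
  map_isProd : ∀ w x, Q.IsProd w x → P.IsProd (w.map toEquiv) (toEquiv x)
  symm_map_isProd : ∀ w x, P.IsProd w x → Q.IsProd (w.map toEquiv.symm) (toEquiv.symm x)

end PartialSystem

/-- Partial groups. -/
structure PartialGroup (α : Type u) extends PartialSystem α where
  /-- (P1) -/
  tail_mem : ∀ x w, w ≠ [] → x :: w ∈ dom → w ∈ dom
  init_mem : ∀ w x, w ≠ [] → w ++ [x] ∈ dom → w ∈ dom
  /-- (P2): contracting a subword `v` to its product `x` gives a multipliable word with the
  same product. -/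
  contract : ∀ u v w x y, toPartialSystem.IsProd v x → toPartialSystem.IsProd (u ++ v ++ w) y →
    toPartialSystem.IsProd (u ++ [x] ++ w) y
  /-- (P3), (P4) -/
  one : α
  insert_one_mem : ∀ u v, u ++ v ∈ dom → u ++ [one] ++ v ∈ dom
  one_mul : ∀ x, toPartialSystem.IsProd [one, x] x
  mul_one : ∀ x, toPartialSystem.IsProd [x, one] x
  /-- (P5), (P6) -/
  inv : α → α
  append_inv_mem : ∀ w ∈ dom, w ++ (w.map inv).reverse ∈ dom
  inv_append_mem : ∀ w ∈ dom, (w.map inv).reverse ++ w ∈ dom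
  mul_inv : ∀ x, toPartialSystem.IsProd [x, inv x] one
  inv_mul : ∀ x, toPartialSystem.IsProd [inv x, x] one

/-- The given words and multi-products form a partial group (unit and inversion are then uniquely
determined). -/
def PartialSystem.IsPartialGroup {α : Type u} (S : PartialSystem α) : Prop :=
  ∃ P : PartialGroup α, P.toPartialSystem = S

namespace PartialGroup

/-- A group as a partial group: every non-empty word is multipliable. -/
def ofGroup (G : Type u) [Group G] : PartialGroup G where
  dom := {w | w ≠ []}
  prod w _ := w.prod
  ne_nil _ h := h
  singleton_mem x := by simp
  prod_singleton x := by simp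
  tail_mem _ _ h _ := h
  init_mem _ _ h _ := h
  contract := by
    rintro u v w x y ⟨hv, rfl⟩ ⟨h, rfl⟩
    exact ⟨by simp, by simp⟩
  one := 1
  insert_one_mem u v _ := by simp
  one_mul x := ⟨by simp, by simp⟩
  mul_one x := ⟨by simp, by simp⟩
  inv x := x⁻¹
  append_inv_mem w h := by simpa using h
  inv_append_mem w h := by simpa using h
  mul_inv x := ⟨by simp, by simp⟩
  inv_mul x := ⟨by simp, by simp⟩

/-- A group homomorphism as a map of partial groups. -/
def homOfGroupHom {G : Type u} {H : Type v} [Group G] [Group H] (f : G →* H) :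
    PartialSystem.Hom (ofGroup G).toPartialSystem (ofGroup H).toPartialSystem where
  toFun := f
  map_isProd := by
    rintro w x ⟨h, rfl⟩
    have h' : w ≠ [] := h
    exact ⟨by simpa [ofGroup] using h', (map_list_prod f w).symm⟩

end PartialGroup

/-! ## The category of partial groups -/

structure PartialGrp : Type (u + 1) where
  carrier : Type u
  str : PartialGroup carrier

instance : Category.{u} PartialGrp.{u} where
  Hom P Q := PartialSystem.Hom P.str.toPartialSystem Q.str.toPartialSystem
  id P := ⟨id, fun w x h => by simpa using h⟩
  comp f g := ⟨g.toFun ∘ f.toFun, fun w x h => by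
    simpa using g.map_isProd _ _ (f.map_isProd _ _ h)⟩

section FiberSum

variable {G₀ : Type u} [Group G₀]

/-- For subgroups `A, B` of a group: `W`, with the maps `jA, jB`, is the fiber sum (pushout)
`A ∨_{A ∩ B} B` of the two inclusions `A ∩ B → A`, `A ∩ B → B` in the category of partial groups. -/
def IsFiberSum (A B : Subgroup G₀) (W : PartialGrp.{u})
    (jA : PartialSystem.Hom (PartialGroup.ofGroup A).toPartialSystem W.str.toPartialSystem)
    (jB : PartialSystem.Hom (PartialGroup.ofGroup B).toPartialSystem W.str.toPartialSystem) :
    Prop :=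
  IsPushout (C := PartialGrp.{u})
    (Z := ⟨_, PartialGroup.ofGroup (A ⊓ B : Subgroup G₀)⟩)
    (X := ⟨_, PartialGroup.ofGroup A⟩) (Y := ⟨_, PartialGroup.ofGroup B⟩) (P := W)
    (PartialGroup.homOfGroupHom (Subgroup.inclusion inf_le_left))
    (PartialGroup.homOfGroupHom (Subgroup.inclusion inf_le_right)) jA jB

/-- The underlying set of `A ∪ B`. -/
abbrev UnionCarrier (A B : Subgroup G₀) : Type u := {g : G₀ // g ∈ A ∨ g ∈ B}

/-- The words `Aⁿ ∪ Bⁿ`, `n ≥ 1`. -/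
def unionDom (A B : Subgroup G₀) : Set (List (UnionCarrier A B)) :=
  {w | w ≠ [] ∧ ((∀ x ∈ w, x.1 ∈ A) ∨ ∀ x ∈ w, x.1 ∈ B)}

theorem unionDom_prod_mem {A B : Subgroup G₀} {w : List (UnionCarrier A B)}
    (h : w ∈ unionDom A B) : (w.map Subtype.val).prod ∈ A ∨ (w.map Subtype.val).prod ∈ B := by
  rcases h.2 with h | h
  · exact Or.inl (Subgroup.list_prod_mem _ (by simpa using fun a _ ha => h _ ha))
  · exact Or.inr (Subgroup.list_prod_mem _ (by simpa using fun a _ ha => h _ ha))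

theorem union_inv_mem {A B : Subgroup G₀} (x : UnionCarrier A B) : x.1⁻¹ ∈ A ∨ x.1⁻¹ ∈ B :=
  x.2.imp A.inv_mem B.inv_mem

/-- The partial group `A ∪ B`, with multipliable words `Aⁿ ∪ Bⁿ` and the product of the ambient
group. -/
def unionPartialGroup (A B : Subgroup G₀) : PartialGroup (UnionCarrier A B) where
  dom := unionDom A B
  prod w h := ⟨(w.map Subtype.val).prod, unionDom_prod_mem h⟩
  ne_nil _ h := h.1
  singleton_mem x := ⟨by simp, by simpa using x.2⟩
  prod_singleton x := by simp
  tail_mem x w hw h := ⟨hw, h.2.imp (fun k y hy => k y (by simp [hy]))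
    (fun k y hy => k y (by simp [hy]))⟩
  init_mem w x hw h := ⟨hw, h.2.imp (fun k y hy => k y (by simp [hy]))
    (fun k y hy => k y (by simp [hy]))⟩
  contract := by
    rintro u v w x y ⟨hv, rfl⟩ ⟨h, rfl⟩
    refine ⟨⟨by simp, ?_⟩, Subtype.ext (by simp)⟩
    refine h.2.imp (fun k => ?_) (fun k => ?_)
    all_goals
      intro y hy
      simp only [List.mem_append, List.mem_singleton] at hy
      rcases hy with (hy | rfl) | hy
      · exact k y (by simp [hy])
      · refine Subgroup.list_prod_mem _ ?_
        intro z hz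
        obtain ⟨z, hz', rfl⟩ := List.mem_map.1 hz
        exact k z (List.mem_append_left _ (List.mem_append_right _ hz'))
      · exact k y (by simp [hy])
  one := ⟨1, Or.inl A.one_mem⟩
  insert_one_mem u v h := by
    refine ⟨by simp, h.2.imp (fun k => ?_) (fun k => ?_)⟩
    all_goals
      intro y hy
      simp only [List.mem_append, List.mem_singleton] at hy
      rcases hy with (hy | rfl) | hy
      · exact k y (by simp [hy])
      · exact Subgroup.one_mem _
      · exact k y (by simp [hy])
  one_mul x := ⟨⟨by simp, x.2.imp (fun k => by simp [k]) (fun k => by simp [k])⟩, by simp⟩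
  mul_one x := ⟨⟨by simp, x.2.imp (fun k => by simp [k]) (fun k => by simp [k])⟩, by simp⟩
  inv x := ⟨x.1⁻¹, union_inv_mem x⟩
  append_inv_mem w h := by
    refine ⟨by simpa using h.1, h.2.imp (fun k => ?_) (fun k => ?_)⟩
    all_goals
      intro y hy
      simp only [List.mem_append, List.mem_reverse, List.mem_map] at hy
      rcases hy with hy | ⟨z, hz, rfl⟩
      · exact k y hy
      · exact Subgroup.inv_mem _ (k z hz)
  inv_append_mem w h := by
    refine ⟨by simpa using h.1, h.2.imp (fun k => ?_) (fun k => ?_)⟩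
    all_goals
      intro y hy
      simp only [List.mem_append, List.mem_reverse, List.mem_map] at hy
      rcases hy with ⟨z, hz, rfl⟩ | hy
      · exact Subgroup.inv_mem _ (k z hz)
      · exact k y hy
  mul_inv x := ⟨⟨by simp, x.2.imp (fun k => by simp [k]) (fun k => by simp [k])⟩, by simp⟩
  inv_mul x := ⟨⟨by simp, x.2.imp (fun k => by simp [k]) (fun k => by simp [k])⟩, by simp⟩

/-- The inclusion `A → A ∪ B`. -/
def unionInl (A B : Subgroup G₀) : PartialSystem.Hom (PartialGroup.ofGroup A).toPartialSystem
    (unionPartialGroup A B).toPartialSystem where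
  toFun g := ⟨g.1, Or.inl g.2⟩
  map_isProd := by
    rintro w x ⟨h, rfl⟩
    have h' : w ≠ [] := h
    refine ⟨⟨by simpa using h', Or.inl ?_⟩, Subtype.ext ?_⟩
    · intro y hy
      obtain ⟨z, -, rfl⟩ := List.mem_map.1 hy
      exact z.2
    · change ((w.map _).map Subtype.val).prod = ((w.prod : A) : G₀)
      rw [List.map_map, SubmonoidClass.coe_list_prod]
      rfl

/-- The inclusion `B → A ∪ B`. -/
def unionInr (A B : Subgroup G₀) : PartialSystem.Hom (PartialGroup.ofGroup B).toPartialSystem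
    (unionPartialGroup A B).toPartialSystem where
  toFun g := ⟨g.1, Or.inr g.2⟩
  map_isProd := by
    rintro w x ⟨h, rfl⟩
    have h' : w ≠ [] := h
    refine ⟨⟨by simpa using h', Or.inr ?_⟩, Subtype.ext ?_⟩
    · intro y hy
      obtain ⟨z, -, rfl⟩ := List.mem_map.1 hy
      exact z.2
    · change ((w.map _).map Subtype.val).prod = ((w.prod : B) : G₀)
      rw [List.map_map, SubmonoidClass.coe_list_prod]
      rfl

end FiberSum

/-! ## Normalizers, factor sets and extensions -/

namespace PartialGroup

variable {α : Type u} (P : PartialGroup α)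

/-- `g` lies in the normalizer `N(𝒫)`. -/
def IsNormal (g : α) : Prop :=
  ∀ u v, u ≠ [] → v ≠ [] → u ++ v ∈ P.dom →
    u ++ [g, P.inv g] ++ v ∈ P.dom ∧ u ++ [P.inv g, g] ++ v ∈ P.dom

/-- The normalizer `N(𝒫)`. -/
abbrev Normalizer : Type u := {g : α // P.IsNormal g}

variable {P}

theorem mem_dom_of_append_left {u v : List α} (hu : u ≠ []) (h : u ++ v ∈ P.dom) : u ∈ P.dom := by
  induction v using List.reverseRecOn with
  | nil => simpa using h
  | append_singleton v x ih =>
    rw [← List.append_assoc] at h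
    exact ih (P.init_mem _ _ (by simp [hu]) h)

theorem mem_dom_of_append_right {u v : List α} (hv : v ≠ []) (h : u ++ v ∈ P.dom) : v ∈ P.dom := by
  induction u with
  | nil => simpa using h
  | cons x u ih => exact ih (P.tail_mem x _ (by simp [hv]) h)

theorem IsNormal.cons_mem {g : α} (hg : P.IsNormal g) {w : List α} (hw : w ∈ P.dom) :
    g :: w ∈ P.dom := by
  have h1 : [P.one] ++ w ∈ P.dom := P.insert_one_mem [] w hw
  have h2 := (hg [P.one] w (by simp) (P.ne_nil _ hw) h1).2
  refine mem_dom_of_append_right (u := [P.one, P.inv g]) (by simp) ?_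
  simpa using h2

theorem isNormal_one : P.IsNormal P.one := by
  have h1 : P.inv P.one = P.one := by
    obtain ⟨h, e⟩ := P.mul_inv P.one
    obtain ⟨h', e'⟩ := P.one_mul (P.inv P.one)
    exact e'.symm.trans e
  intro u v _ _ h
  rw [h1]
  have := P.insert_one_mem (u ++ [P.one]) v (P.insert_one_mem u v h)
  simp at this
  simpa using this

/-- Inverses are unique. -/
theorem eq_inv_of_isProd {x y : α} (h : P.IsProd [x, y] P.one) : y = P.inv x := by
  have hm : [P.inv x, x, y] ∈ P.dom := by
    have := P.inv_append_mem _ h.1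
    have h2 : [P.inv y] ++ [P.inv x, x, y] ∈ P.dom := by simpa using this
    exact mem_dom_of_append_right (by simp) h2
  have h3 : P.IsProd ([] ++ [P.inv x, x] ++ [y]) (P.prod _ hm) := ⟨hm, rfl⟩
  have h4 : P.IsProd ([P.inv x] ++ [x, y] ++ []) (P.prod _ hm) := ⟨hm, rfl⟩
  obtain ⟨_, e1⟩ := P.contract _ _ _ _ _ (P.inv_mul x) h3
  obtain ⟨_, e2⟩ := P.contract _ _ _ _ _ h h4
  obtain ⟨_, e3⟩ := P.one_mul y
  obtain ⟨_, e4⟩ := P.mul_one (P.inv x)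
  exact e3.symm.trans (e1.trans (e2.symm.trans e4))

theorem IsNormal.prod_isNormal {g h : α} (hg : P.IsNormal g) (hh : P.IsNormal h)
    (hgh : [g, h] ∈ P.dom) : P.IsNormal (P.prod _ hgh) := by
  have hinv : P.IsProd [P.inv h, P.inv g] (P.inv (P.prod _ hgh)) := by
    have h1 : [g, h] ++ [P.inv h, P.inv g] ∈ P.dom := by simpa using P.append_inv_mem _ hgh
    have h2 : [P.inv h, P.inv g] ∈ P.dom := mem_dom_of_append_right (by simp) h1
    refine ⟨h2, eq_inv_of_isProd ?_⟩
    have h3 : P.IsProd ([g] ++ [h, P.inv h] ++ [P.inv g]) (P.prod _ h1) := ⟨h1, rfl⟩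
    have h4 := P.contract _ _ _ _ _ (P.mul_inv h) h3
    have h5 := P.contract [] [g, P.one] [P.inv g] _ _ (P.mul_one g) h4
    obtain ⟨_, e5⟩ := h5
    obtain ⟨_, e6⟩ := P.mul_inv g
    have e : P.prod _ h1 = P.one := e5.symm.trans e6
    have h7 : P.IsProd ([] ++ [g, h] ++ [P.inv h, P.inv g]) P.one := ⟨h1, e⟩
    have h8 := P.contract _ _ _ _ _ ⟨hgh, rfl⟩ h7
    exact P.contract [P.prod _ hgh] [P.inv h, P.inv g] [] _ _ ⟨h2, rfl⟩ h8
  intro u v hu hv huv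
  constructor
  · have h1 := (hg u v hu hv huv).1
    have h2 := (hh (u ++ [g]) ([P.inv g] ++ v) (by simp) (by simp) (by simpa using h1)).1
    have h3 : P.IsProd (u ++ [g, h] ++ ([P.inv h, P.inv g] ++ v))
        (P.prod _ h2) := ⟨by simpa using h2, by simp⟩
    have h4 := P.contract _ _ _ _ _ ⟨hgh, rfl⟩ h3
    have h5 := P.contract (u ++ [P.prod _ hgh]) _ v _ _ hinv (by simpa using h4)
    simpa using h5.1
  · have h1 := (hh u v hu hv huv).2
    have h2 := (hg (u ++ [P.inv h]) ([h] ++ v) (by simp) (by simp) (by simpa using h1)).2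
    have h3 : P.IsProd (u ++ [P.inv h, P.inv g] ++ ([g, h] ++ v))
        (P.prod _ h2) := ⟨by simpa using h2, by simp⟩
    have h4 := P.contract _ _ _ _ _ hinv h3
    have h5 := P.contract (u ++ [P.inv (P.prod _ hgh)]) _ v _ _ ⟨hgh, rfl⟩ (by simpa using h4)
    simpa using h5.1

/-- The unit and the product of the normalizer. -/
instance : One P.Normalizer := ⟨⟨P.one, isNormal_one⟩⟩

instance : Mul P.Normalizer :=
  ⟨fun g h => ⟨P.prod [g.1, h.1] (g.2.cons_mem (P.singleton_mem h.1)), g.2.prod_isNormal h.2 _⟩⟩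

end PartialGroup

/-- A factor set `(↼, σ)` for `(ℋ, G)`. -/
structure FactorSet {α : Type u} (H : PartialGroup α) (G : Type v) [Group G] where
  act : α → G → α
  σ : G → G → H.Normalizer
  /-- (FS1) -/
  act_one : ∀ x, act x 1 = x
  σ_one_left : ∀ a, σ 1 a = 1
  σ_one_right : ∀ a, σ a 1 = 1
  /-- (FS2) -/
  act_isProd : ∀ a w x, H.IsProd w x → H.IsProd (w.map (act · a)) (act x a)
  /-- (FS3): `(x ↼ a) ↼ b = σ(a,b)⁻¹ · (x ↼ ab) · σ(a,b)` -/
  act_act : ∀ x a b,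
    H.IsProd [H.inv (σ a b).1, act x (a * b), (σ a b).1] (act (act x a) b)
  /-- (FS4): `σ(a,bc) σ(b,c) = σ(ab,c) (σ(a,b) ↼ c)` in the normalizer -/
  cocycle : ∀ a b c,
    H.IsProd [(σ (a * b) c).1, act (σ a b).1 c] (σ a (b * c) * σ b c).1

namespace FactorSet

variable {α : Type u} {H : PartialGroup α} {G : Type v} [Group G] (τ : FactorSet H G)

/-- `A((c₁,η₁),…,(cₙ,ηₙ)) = (η₁ ↼ (c₂,…,cₙ), …, ηₙ₋₁ ↼ cₙ, ηₙ)`, where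
`η ↼ (c₂,…,cₙ) = (⋯(η ↼ c₂)⋯) ↼ cₙ`. -/
def twist : List (G × α) → List α
  | [] => []
  | p :: t => (t.map Prod.fst).foldl τ.act p.2 :: twist t

/-- `σ(c₁,…,cₙ) = σ(c₁,c₂⋯cₙ) σ(c₂,c₃⋯cₙ) ⋯ σ(cₙ₋₁,cₙ)`, a product in the normalizer
(the last factor `σ(cₙ, 1)` produced by the recursion is `1`). -/
def σList : List G → H.Normalizer
  | [] => 1
  | c :: t => τ.σ c t.prod * σList t

/-- The extension `G ⋉_{↼,σ} ℋ` on the set `G × ℋ₁`: a word `α` is multipliable iff `A(α)` is, and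
`∇ α = (c₁⋯cₙ, ∇(σ(c₁,…,cₙ), A(α)))`. -/
def extension : PartialSystem (G × α) where
  dom := {w | τ.twist w ∈ H.dom}
  prod w h := ((w.map Prod.fst).prod,
    H.prod ((τ.σList (w.map Prod.fst)).1 :: τ.twist w)
      ((τ.σList (w.map Prod.fst)).2.cons_mem h))
  ne_nil := by
    rintro w h rfl
    exact H.ne_nil _ h rfl
  singleton_mem x := H.singleton_mem x.2
  prod_singleton x := by
    have hσ : (τ.σ x.1 1 * 1 : H.Normalizer).1 = H.one := by
      rw [τ.σ_one_right]
      exact (H.one_mul H.one).2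
    obtain ⟨h, e⟩ := H.one_mul x.2
    refine Prod.ext (by simp) ?_
    simp only [List.map_cons, List.map_nil, σList, List.prod_nil, twist, List.foldl_nil, hσ]
    exact e

end FactorSet

/-- A (right) `G`-partial group structure on `ℋ`: a right `G`-action on `ℋ₁` by automorphisms of the
partial group `ℋ`. -/
structure GPartialGroup {α : Type u} (H : PartialGroup α) (G : Type v) [Group G] where
  act : α → G → α
  act_one : ∀ x, act x 1 = x
  act_act : ∀ x a b, act (act x a) b = act x (a * b)
  act_isProd : ∀ a w x, H.IsProd w x → H.IsProd (w.map (act · a)) (act x a)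

namespace GPartialGroup

variable {α : Type u} {H : PartialGroup α} {G : Type v} [Group G] (ρ : GPartialGroup H G)

/-- The factor set `(↼, σ)` with `σ ≡ 1` defined by an action. -/
def toFactorSet : FactorSet H G where
  act := ρ.act
  σ _ _ := 1
  act_one := ρ.act_one
  σ_one_left _ := rfl
  σ_one_right _ := rfl
  act_isProd := ρ.act_isProd
  act_act x a b := by
    rw [ρ.act_act]
    have h1 : H.inv H.one = H.one := by
      obtain ⟨h, e⟩ := H.mul_inv H.one
      obtain ⟨h', e'⟩ := H.one_mul (H.inv H.one)
      exact e'.symm.trans e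
    change H.IsProd [H.inv H.one, ρ.act x (a * b), H.one] _
    rw [h1]
    have h2 := H.insert_one_mem [] _ (H.mul_one (ρ.act x (a * b))).1
    refine ⟨h2, ?_⟩
    obtain ⟨_, e1⟩ := H.contract [] [H.one, ρ.act x (a * b)] [H.one] _ _ (H.one_mul _) ⟨h2, rfl⟩
    exact e1.symm.trans (H.mul_one _).2
  cocycle a b c := by
    have h1 : ρ.act H.one c = H.one := by
      have h := ρ.act_isProd c _ _ (H.one_mul H.one)
      have h' : H.IsProd [ρ.act H.one c, ρ.act H.one c] (ρ.act H.one c) := by simpa using h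
      set e := ρ.act H.one c
      have hm : [H.inv e, e, e] ∈ H.dom := by
        have := H.inv_append_mem _ h'.1
        have h2 : [H.inv e] ++ [H.inv e, e, e] ∈ H.dom := by simpa using this
        exact PartialGroup.mem_dom_of_append_right (by simp) h2
      obtain ⟨_, e1⟩ := H.contract [] [H.inv e, e] [e] _ _ (H.inv_mul e) ⟨hm, rfl⟩
      obtain ⟨_, e2⟩ := H.contract [H.inv e] [e, e] [] _ _ h' ⟨hm, rfl⟩
      exact (H.one_mul e).2.symm.trans (e1.trans (e2.symm.trans (H.inv_mul e).2))
    change H.IsProd [H.one, ρ.act H.one c] _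
    rw [h1]
    exact ⟨(H.one_mul H.one).1, rfl⟩

/-- The semidirect product `G ⋉ ℋ`, i.e. `G ⋉_{↼,σ} ℋ` with `σ ≡ 1`. -/
def semidirect : PartialSystem (G × α) := ρ.toFactorSet.extension

end GPartialGroup

/-! ## Parades -/

section Parade

variable {G₀ : Type u} [Group G₀] {X₀ : Type v} [MulAction G₀ᵐᵒᵖ X₀]

/-- The group `G(X) = {a ∈ G₀ | X a = X}` for a subset `X` of a right `G₀`-set. -/
def symmetryGroup (G₀ : Type u) [Group G₀] [MulAction G₀ᵐᵒᵖ X₀] (X : Set X₀) : Subgroup G₀ where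
  carrier := {a | X <• a = X}
  one_mem' := by simp
  mul_mem' {a b} ha hb := by
    change X <• (a * b) = X
    rw [MulOpposite.op_mul, mul_smul, show X <• a = X from ha, show X <• b = X from hb]
  inv_mem' {a} ha := by
    change X <• a⁻¹ = X
    rw [MulOpposite.op_inv, inv_smul_eq_iff]
    exact (show X <• a = X from ha).symm

/-- The word `(π₁,…,πₙ)` is a parade in `X` with starting point `x`: all of
`x, xπ₁, …, xπ₁⋯πₙ` lie in `X`. -/
def IsRoute (X : Set X₀) : X₀ → List G₀ → Prop
  | x, [] => x ∈ X
  | x, g :: t => x ∈ X ∧ IsRoute X (x <• g) t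

theorem isRoute_append (X : Set X₀) (x : X₀) (u v : List G₀) :
    IsRoute X x (u ++ v) ↔ IsRoute X x u ∧ IsRoute X (x <• u.prod) v := by
  induction u generalizing x with
  | nil =>
    have key : IsRoute X x v → x ∈ X := by
      cases v with
      | nil => exact id
      | cons g t => exact And.left
    simpa [IsRoute] using key
  | cons g t ih => simp [IsRoute, ih, mul_smul, and_assoc]

theorem IsRoute.start_mem {X : Set X₀} {x : X₀} {w : List G₀} (h : IsRoute X x w) : x ∈ X := by
  cases w with
  | nil => exact h
  | cons g t => exact h.1

theorem IsRoute.end_mem {X : Set X₀} {x : X₀} {w : List G₀} (h : IsRoute X x w) :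
    x <• w.prod ∈ X := by
  have : IsRoute X x (w ++ []) := by simpa using h
  exact ((isRoute_append X x w []).1 this).2

theorem IsRoute.inv {X : Set X₀} {x : X₀} {w : List G₀} (h : IsRoute X x w) :
    IsRoute X (x <• w.prod) (w.map (·⁻¹)).reverse := by
  induction w generalizing x with
  | nil => simpa [IsRoute] using h
  | cons g t ih =>
    have h2 := ih h.2
    simp only [List.map_cons, List.reverse_cons, isRoute_append]
    have e : (x <• (g :: t).prod) = ((x <• g) <• t.prod) := by simp [mul_smul]
    have e2 : (((x <• g) <• t.prod) <• (t.map (·⁻¹)).reverse.prod) = (x <• g) := by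
      rw [← List.prod_inv_reverse, MulOpposite.op_inv, inv_smul_smul]
    rw [e]
    refine ⟨h2, ?_, ?_⟩
    · rw [e2]; exact h.2.start_mem
    · rw [e2, MulOpposite.op_inv, inv_smul_smul]; exact h.start_mem

/-- The set `𝒫(X)₁` of elements of `G₀` carrying some point of `X` into `X`. -/
abbrev ParadeCarrier (G₀ : Type u) [Group G₀] [MulAction G₀ᵐᵒᵖ X₀] (X : Set X₀) : Type u :=
  {g : G₀ // ∃ x, IsRoute X x [g]}

/-- The partial group `𝒫(X) = 𝒫(X, X₀, G₀)` of parades in a non-empty subset `X` of a right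
`G₀`-set `X₀`, with the product of `G₀`. -/
def paradePartialGroup (G₀ : Type u) [Group G₀] [MulAction G₀ᵐᵒᵖ X₀] (X : Set X₀)
    (hX : X.Nonempty) : PartialGroup (ParadeCarrier G₀ X) where
  dom := {w | w ≠ [] ∧ ∃ x, IsRoute X x (w.map Subtype.val)}
  prod w h := ⟨(w.map Subtype.val).prod, by
    obtain ⟨-, x, hx⟩ := h
    exact ⟨x, hx.start_mem, hx.end_mem⟩⟩
  ne_nil _ h := h.1
  singleton_mem x := ⟨by simp, by simpa using x.2⟩
  prod_singleton x := by simp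
  tail_mem := by
    rintro g w hw ⟨-, x, hx⟩
    exact ⟨hw, _, hx.2⟩
  init_mem := by
    rintro w g hw ⟨-, x, hx⟩
    rw [List.map_append, isRoute_append] at hx
    exact ⟨hw, x, hx.1⟩
  contract := by
    rintro u v w x y ⟨hv, rfl⟩ ⟨⟨-, z, hz⟩, rfl⟩
    refine ⟨⟨by simp, z, ?_⟩, Subtype.ext (by simp)⟩
    simp only [List.map_append, isRoute_append, List.prod_append, MulOpposite.op_mul,
      mul_smul] at hz
    simp only [List.map_append, isRoute_append, List.prod_append, MulOpposite.op_mul,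
      mul_smul, List.map_cons, List.map_nil, List.prod_cons, List.prod_nil, one_smul,
      MulOpposite.op_one]
    exact ⟨⟨hz.1.1, hz.1.2.start_mem, hz.1.2.end_mem⟩, hz.2⟩
  one := ⟨1, hX.some, hX.some_mem, by simpa [IsRoute] using hX.some_mem⟩
  insert_one_mem := by
    rintro u v ⟨-, z, hz⟩
    refine ⟨by simp, z, ?_⟩
    simp only [List.map_append, isRoute_append, List.map_cons, List.map_nil, List.prod_append,
      List.prod_cons, List.prod_nil, mul_one] at hz ⊢
    exact ⟨⟨hz.1, hz.1.end_mem, by simpa [IsRoute] using hz.1.end_mem⟩, hz.2⟩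
  one_mul := by
    rintro ⟨g, x, hx⟩
    exact ⟨⟨by simp, x, hx.start_mem, by simpa using hx⟩, by simp⟩
  mul_one := by
    rintro ⟨g, x, hx⟩
    exact ⟨⟨by simp, x, hx.start_mem, hx.2, by
      change ((x <• g) <• (1 : G₀)) ∈ X
      simpa [IsRoute] using hx.2⟩, by simp⟩
  inv g := ⟨g.1⁻¹, by
    obtain ⟨g, x, hx⟩ := g
    exact ⟨_, hx.inv⟩⟩
  append_inv_mem := by
    rintro w ⟨hw, x, hx⟩
    refine ⟨by simpa using hw, x, ?_⟩
    rw [List.map_append, isRoute_append]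
    refine ⟨hx, ?_⟩
    simpa [List.map_reverse, Function.comp_def] using hx.inv
  inv_append_mem := by
    rintro w ⟨hw, x, hx⟩
    refine ⟨by simpa using hw, x <• (w.map Subtype.val).prod, ?_⟩
    rw [List.map_append, isRoute_append]
    have e : ((w.map fun g : ParadeCarrier G₀ X => (⟨g.1⁻¹, by
        obtain ⟨g, x, hx⟩ := g
        exact ⟨_, hx.inv⟩⟩ : ParadeCarrier G₀ X)).reverse.map Subtype.val)
        = ((w.map Subtype.val).map (·⁻¹)).reverse := by
      simp [List.map_reverse, Function.comp_def]
    rw [e]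
    refine ⟨hx.inv, ?_⟩
    rw [← List.prod_inv_reverse, MulOpposite.op_inv, inv_smul_smul]
    exact hx
  mul_inv := by
    rintro ⟨g, x, hx⟩
    exact ⟨⟨by simp, x, hx.start_mem, hx.2, by
      change ((x <• g) <• g⁻¹) ∈ X
      simpa using hx.start_mem⟩, by simp⟩
  inv_mul := by
    rintro ⟨g, x, hx⟩
    refine ⟨⟨by simp, x <• g, hx.2, ?_, ?_⟩, by simp⟩
    · simpa using hx.start_mem
    · change (((x <• g) <• g⁻¹) <• g) ∈ X
      simpa [IsRoute] using hx.2

end Parade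

/-! ## Figures in Euclidean space -/

/-- The `d`-dimensional Euclidean space. -/
abbrev Euc (d : ℕ) : Type := EuclideanSpace ℝ (Fin d)

/-- The Euclidean group `E(d)` of all isometries of `ℝᵈ`, written so that it acts from the right:
`ab` means "first `a`, then `b`". -/
def EGroup (d : ℕ) : Type := (Euc d ≃ᵃⁱ[ℝ] Euc d)ᵐᵒᵖ

noncomputable instance (d : ℕ) : Group (EGroup d) := inferInstanceAs (Group (Euc d ≃ᵃⁱ[ℝ] Euc d)ᵐᵒᵖ)

/-- The isometry of `ℝᵈ` underlying an element of `E(d)`. -/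
noncomputable def EGroup.toIsometry {d : ℕ} (a : EGroup d) : Euc d ≃ᵃⁱ[ℝ] Euc d := MulOpposite.unop a

/-- The right action of `E(d)` on `ℝᵈ`; together with `Pointwise` it gives the right action
`F ↦ F a` on the power set of `ℝᵈ`. -/
noncomputable instance (d : ℕ) : MulAction (EGroup d)ᵐᵒᵖ (Euc d) where
  smul b x := b.unop.toIsometry x
  one_smul _ := rfl
  mul_smul _ _ _ := rfl

/-- The determinant of the linear part of an isometry. -/
noncomputable def EGroup.det {d : ℕ} (a : EGroup d) : ℝ :=
  LinearMap.det (a.toIsometry.linearIsometryEquiv.toLinearEquiv : Euc d →ₗ[ℝ] Euc d)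

/-- The motion group `M(d)`: the orientation-preserving isometries. -/
noncomputable def MGroup (d : ℕ) : Subgroup (EGroup d) where
  carrier := {a | a.det = 1}
  one_mem' := LinearMap.det_id
  mul_mem' {a b} ha hb := by
    have h : (a * b).det = b.det * a.det := LinearMap.det_comp _ _
    change (a * b).det = 1
    rw [h, show a.det = 1 from ha, show b.det = 1 from hb, mul_one]
  inv_mem' {a} ha := by
    have h : (a⁻¹ * a).det = a.det * a⁻¹.det := LinearMap.det_comp _ _
    have h1 : (1 : EGroup d).det = 1 := LinearMap.det_id
    change a⁻¹.det = 1
    rw [inv_mul_cancel, h1, show a.det = 1 from ha, one_mul] at h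
    exact h.symm

/-- Subgroups of `E(d)` act on `ℝᵈ` from the right by restriction. -/
noncomputable instance (d : ℕ) (S : Subgroup (EGroup d)) : MulAction Sᵐᵒᵖ (Euc d) :=
  MulAction.compHom (Euc d) S.subtype.op

/-- The collection `cc(F)` of connected components of `F`. -/
def cc {d : ℕ} (F : Set (Euc d)) : Set (Set (Euc d)) :=
  {K | ∃ x ∈ F, K = connectedComponentIn F x}

theorem cc_nonempty {d : ℕ} {F : Set (Euc d)} (hF : F.Nonempty) : (cc F).Nonempty :=
  ⟨_, hF.some, hF.some_mem, rfl⟩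

/-- The symmetry group `G(F) = G(F, ℝᵈ, E(d))`. -/
noncomputable def symG {d : ℕ} (F : Set (Euc d)) : Subgroup (EGroup d) := symmetryGroup (EGroup d) F

/-- The special symmetry group `SG(F) = G(F, ℝᵈ, M(d))`. -/
noncomputable def symSG {d : ℕ} (F : Set (Euc d)) : Subgroup (MGroup d) := symmetryGroup (MGroup d) F

/-- The symmetry partial group `𝒫(F) = 𝒫(cc(F), 𝔓(ℝᵈ), E(d))` of a (non-empty) figure. -/
noncomputable def symP {d : ℕ} (F : Set (Euc d)) (hF : F.Nonempty) :
    PartialGroup (ParadeCarrier (EGroup d) (cc F)) :=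
  paradePartialGroup (EGroup d) (cc F) (cc_nonempty hF)

/-- The special symmetry partial group `S𝒫(F) = 𝒫(cc(F), 𝔓(ℝᵈ), M(d))`. -/
noncomputable def symSP {d : ℕ} (F : Set (Euc d)) (hF : F.Nonempty) :
    PartialGroup (ParadeCarrier (MGroup d) (cc F)) :=
  paradePartialGroup (MGroup d) (cc F) (cc_nonempty hF)

/-- The cyclic group of order two. -/
abbrev C₂ : Type := Multiplicative (ZMod 2)

/-- The generator of `C₂`. -/
def C₂.gen : C₂ := Multiplicative.ofAdd 1

/-! Write `X = {F₊, F₋}`. An element carrying a component `K` to a component `L` can be corrected by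
a unique power `aⁱ`, `i ∈ {0, 1}`, with `K aⁱ = L`; the remaining factor then fixes `L`. So every
letter of a parade is `aⁱ η` with `η` in `G(F₊) ∪ G(F₋)`. The form is unique, because `a` fixes
neither component, while an element fixing one of the two and carrying the other into `X` must fix
both.

Take a word of letters `uᵢ ηᵢ`, where `uᵢ` is the chosen power of `a`. Moving all `uᵢ` to the left
gives `u₁⋯uₙ · ρ₁⋯ρₙ`, where `ρᵢ` is `ηᵢ` conjugated by `uᵢ₊₁⋯uₙ`. The word is a parade from `K`
exactly when each `ηᵢ` fixes `K u₁⋯uᵢ`. After conjugation this says that every `ρᵢ` fixes the single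
set `K u₁⋯uₙ`, which is multipliability of the twisted word in `G(F₊) ∪ G(F₋)` (`isRoute_iff_twist`,
`mem_extension_dom_iff`). The powers `u₁⋯uₙ` differ from the chosen power for `c₁⋯cₙ` by
`σ(c₁,…,cₙ)` (`lift_prod_mul_σList`), so the products agree too.

The union `A ∪ B` is the pushout because each of its words lies entirely in `A` or entirely in `B`
(`isFiberSum_union`). For any other pushout the factor set is transported along the canonical
isomorphism. Nothing here depends on Euclidean geometry: the argument works for two subsets of any
right `G₀`-set, and is applied to `E(d)` and to `M(d)`. -/

namespace PartialSystem

/-! ### Isomorphisms of partial systems -/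

theorem IsProd.unique {α : Type u} {P : PartialSystem α} {w : List α} {x y : α}
    (hx : P.IsProd w x) (hy : P.IsProd w y) : x = y := by
  obtain ⟨h, rfl⟩ := hx
  exact hy.2

namespace Iso

variable {α β γ : Type*} {Q : PartialSystem α} {P : PartialSystem β} {R : PartialSystem γ}

/-- The inverse isomorphism. -/
def symm (e : Iso Q P) : Iso P Q := ⟨e.toEquiv.symm, e.symm_map_isProd, e.map_isProd⟩

/-- The composition of two isomorphisms. -/
def trans (e : Iso Q P) (f : Iso P R) : Iso Q R where
  toEquiv := e.toEquiv.trans f.toEquiv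
  map_isProd w x h := by simpa using f.map_isProd _ _ (e.map_isProd _ _ h)
  symm_map_isProd w x h := by simpa using e.symm_map_isProd _ _ (f.symm_map_isProd _ _ h)

theorem isProd_iff (e : Iso Q P) {w : List α} {x : α} :
    P.IsProd (w.map e.toEquiv) (e.toEquiv x) ↔ Q.IsProd w x :=
  ⟨fun h => by simpa using e.symm_map_isProd _ _ h, e.map_isProd w x⟩

theorem mem_dom_iff (e : Iso Q P) {w : List α} : w.map e.toEquiv ∈ P.dom ↔ w ∈ Q.dom := by
  constructor
  · intro h
    have h' := (e.symm_map_isProd _ _ ⟨h, rfl⟩).1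
    simpa using h'
  · exact fun h => (e.map_isProd _ _ ⟨h, rfl⟩).1

/-- A bijection that preserves and reflects products is an isomorphism. -/
def ofIsProdIff (e : α ≃ β) (h : ∀ w x, Q.IsProd w x ↔ P.IsProd (w.map e) (e x)) : Iso Q P where
  toEquiv := e
  map_isProd w x := (h w x).1
  symm_map_isProd w x hx := (h _ _).2 (by simpa using hx)

/-- The axioms only concern products and multipliable words, so they pull back along an isomorphism.
This spares a direct verification for the extensions: they inherit the axioms from the partial group
of parades. -/
theorem isPartialGroup {Q : PartialSystem α} {P : PartialGroup β}
    (e : Iso Q P.toPartialSystem) : Q.IsPartialGroup := by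
  refine ⟨{ toPartialSystem := Q
            one := e.toEquiv.symm P.one
            inv := fun x => e.toEquiv.symm (P.inv (e.toEquiv x))
            tail_mem := ?_
            init_mem := ?_
            contract := ?_
            insert_one_mem := ?_
            one_mul := ?_
            mul_one := ?_
            append_inv_mem := ?_
            inv_append_mem := ?_
            mul_inv := ?_
            inv_mul := ?_ }, rfl⟩
  · intro x w hw h
    rw [← e.mem_dom_iff] at h ⊢
    exact P.tail_mem (e.toEquiv x) _ (by simpa using hw) (by simpa using h)
  · intro w x hw h
    rw [← e.mem_dom_iff] at h ⊢
    exact P.init_mem _ (e.toEquiv x) (by simpa using hw) (by simpa using h)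
  · intro u v w x y hv h
    rw [← e.isProd_iff] at hv h ⊢
    simpa using P.contract _ _ (w.map e.toEquiv) _ _ hv (by simpa using h)
  · intro u v h
    rw [← e.mem_dom_iff] at h ⊢
    simpa using P.insert_one_mem (u.map e.toEquiv) (v.map e.toEquiv) (by simpa using h)
  · intro x
    rw [← e.isProd_iff]
    simpa using P.one_mul (e.toEquiv x)
  · intro x
    rw [← e.isProd_iff]
    simpa using P.mul_one (e.toEquiv x)
  · intro w h
    rw [← e.mem_dom_iff] at h ⊢
    simpa [Function.comp_def] using P.append_inv_mem _ h
  · intro w h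
    rw [← e.mem_dom_iff] at h ⊢
    simpa [Function.comp_def] using P.inv_append_mem _ h
  · intro x
    rw [← e.isProd_iff]
    simpa using P.mul_inv (e.toEquiv x)
  · intro x
    rw [← e.isProd_iff]
    simpa using P.inv_mul (e.toEquiv x)

section PartialGroup

variable {H : PartialGroup α} {K : PartialGroup β}

/-- The word `(e 1, 1)` has product `1`, as the image of `(1, e⁻¹ 1)`, and product `e 1`, by the
unit law in `K`. -/
theorem map_one (e : Iso H.toPartialSystem K.toPartialSystem) : e.toEquiv H.one = K.one := by
  have h := e.isProd_iff.2 (H.one_mul (e.toEquiv.symm K.one))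
  simp only [List.map_cons, List.map_nil, Equiv.apply_symm_apply] at h
  exact (K.mul_one (e.toEquiv H.one)).unique h

theorem map_inv (e : Iso H.toPartialSystem K.toPartialSystem) (x : α) :
    e.toEquiv (H.inv x) = K.inv (e.toEquiv x) := by
  apply K.eq_inv_of_isProd
  simpa [e.map_one] using e.map_isProd _ _ (H.mul_inv x)

theorem isNormal_map (e : Iso H.toPartialSystem K.toPartialSystem) {g : α} (hg : H.IsNormal g) :
    K.IsNormal (e.toEquiv g) := by
  intro u v hu hv huv
  have h := hg (u.map e.toEquiv.symm) (v.map e.toEquiv.symm) (by simpa using hu)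
    (by simpa using hv) (by rw [← e.mem_dom_iff]; simpa using huv)
  rw [← e.mem_dom_iff, ← e.mem_dom_iff] at h
  simpa [e.map_inv] using h

/-- The bijection of normalizers induced by an isomorphism. -/
def mapNormalizer (e : Iso H.toPartialSystem K.toPartialSystem) (g : H.Normalizer) :
    K.Normalizer :=
  ⟨e.toEquiv g.1, e.isNormal_map g.2⟩

theorem mapNormalizer_one (e : Iso H.toPartialSystem K.toPartialSystem) :
    e.mapNormalizer 1 = 1 :=
  Subtype.ext e.map_one

theorem mapNormalizer_mul (e : Iso H.toPartialSystem K.toPartialSystem) (g h : H.Normalizer) :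
    e.mapNormalizer (g * h) = e.mapNormalizer g * e.mapNormalizer h := by
  apply Subtype.ext
  have h1 : H.IsProd [g.1, h.1] (g * h).1 := ⟨_, rfl⟩
  have h2 := e.map_isProd _ _ h1
  exact h2.2.symm

end PartialGroup

end Iso

end PartialSystem

open PartialSystem

/-! ### Transport of factor sets and extensions -/

namespace FactorSet

variable {α β : Type*} {H : PartialGroup α} {K : PartialGroup β} {G : Type*} [Group G]

/-- Transport of a factor set along an isomorphism of partial groups. -/
def transport (e : Iso H.toPartialSystem K.toPartialSystem) (τ : FactorSet H G) :
    FactorSet K G where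
  act x g := e.toEquiv (τ.act (e.toEquiv.symm x) g)
  σ a b := e.mapNormalizer (τ.σ a b)
  act_one x := by simp [τ.act_one]
  σ_one_left a := by rw [τ.σ_one_left, e.mapNormalizer_one]
  σ_one_right a := by rw [τ.σ_one_right, e.mapNormalizer_one]
  act_isProd a w x h := by
    simpa [Function.comp_def] using
      e.map_isProd _ _ (τ.act_isProd a _ _ (e.symm_map_isProd _ _ h))
  act_act x a b := by
    simpa [Iso.mapNormalizer, e.map_inv] using
      e.map_isProd _ _ (τ.act_act (e.toEquiv.symm x) a b)
  cocycle a b c := by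
    rw [← e.mapNormalizer_mul]
    simpa [Iso.mapNormalizer] using e.map_isProd _ _ (τ.cocycle a b c)

theorem transport_twist (e : Iso H.toPartialSystem K.toPartialSystem) (τ : FactorSet H G)
    (w : List (G × α)) :
    (τ.transport e).twist (w.map (Prod.map id e.toEquiv)) = (τ.twist w).map e.toEquiv := by
  have hfold : ∀ (l : List G) (x : α),
      l.foldl (τ.transport e).act (e.toEquiv x) = e.toEquiv (l.foldl τ.act x) := by
    intro l
    induction l with
    | nil => simp
    | cons g l ih => intro x; simp [← ih, transport]
  induction w with
  | nil => rfl
  | cons p t ih =>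
    simp only [twist, List.map_cons, ih, Prod.map_snd, hfold, List.map_map]
    rfl

theorem transport_σList (e : Iso H.toPartialSystem K.toPartialSystem) (τ : FactorSet H G)
    (l : List G) : (τ.transport e).σList l = e.mapNormalizer (τ.σList l) := by
  induction l with
  | nil => exact e.mapNormalizer_one.symm
  | cons g l ih =>
    rw [σList, ih, σList, e.mapNormalizer_mul]
    rfl

/-- The condition on the twisted word alone matters for the empty word: there the last word is
`(1)`, which is multipliable although the empty word is not. -/
theorem extension_isProd_iff (τ : FactorSet H G) {w : List (G × α)} {x : G × α} :
    τ.extension.IsProd w x ↔ τ.twist w ∈ H.dom ∧ (w.map Prod.fst).prod = x.1 ∧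
      H.IsProd ((τ.σList (w.map Prod.fst)).1 :: τ.twist w) x.2 := by
  constructor
  · rintro ⟨h, rfl⟩
    exact ⟨h, rfl, _, rfl⟩
  · rintro ⟨h, h1, _, h2⟩
    exact ⟨h, Prod.ext h1 h2⟩

/-- Transporting a factor set along an isomorphism does not change the extension. -/
def transportIso (e : Iso H.toPartialSystem K.toPartialSystem) (τ : FactorSet H G) :
    Iso τ.extension (τ.transport e).extension :=
  Iso.ofIsProdIff ((Equiv.refl G).prodCongr e.toEquiv) fun w x => by
    have h1 : w.map ((Equiv.refl G).prodCongr e.toEquiv) = w.map (Prod.map id e.toEquiv) := rfl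
    have h2 : (w.map (Prod.map id e.toEquiv)).map Prod.fst = w.map Prod.fst := by simp
    rw [extension_isProd_iff, extension_isProd_iff, h1, h2, transport_twist, transport_σList,
      e.mem_dom_iff, ← e.isProd_iff (x := x.2)]
    rfl

end FactorSet

/-! ### The union of two subgroups as a pushout -/

section FiberSum

variable {G₀ : Type u} [Group G₀]

theorem union_isProd_iff {A B : Subgroup G₀} {w : List (UnionCarrier A B)}
    {x : UnionCarrier A B} :
    (unionPartialGroup A B).IsProd w x ↔ w ∈ unionDom A B ∧ (w.map Subtype.val).prod = x.1 :=
  ⟨fun ⟨h, e⟩ => ⟨h, congrArg Subtype.val e⟩, fun ⟨h, e⟩ => ⟨h, Subtype.ext e⟩⟩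

/-- Letters from `A ∩ B` can be inserted into a word over `A` as well as into a word over `B`. Only
this inclusion of `A ∩ B` in the normalizer is needed, as a home for the values of `σ`. -/
theorem union_isNormal {A B : Subgroup G₀} {g : UnionCarrier A B} (hA : g.1 ∈ A) (hB : g.1 ∈ B) :
    (unionPartialGroup A B).IsNormal g := by
  have key : ∀ u v g' g'', u ++ v ∈ unionDom A B → g'.1 ∈ A → g'.1 ∈ B → g''.1 ∈ A → g''.1 ∈ B →
      u ++ [g', g''] ++ v ∈ unionDom A B := by
    intro u v g' g'' h hA' hB' hA'' hB''
    refine ⟨by simp, h.2.imp (fun k x hx => ?_) (fun k x hx => ?_)⟩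
    all_goals
      have hx' : x ∈ u ++ v ∨ x = g' ∨ x = g'' := by
        simp only [List.mem_append, List.mem_cons, List.not_mem_nil, or_false] at hx ⊢
        tauto
      rcases hx' with hx' | rfl | rfl
      · exact k x hx'
      · assumption
      · assumption
  intro u v _ _ h
  exact ⟨key u v _ _ h hA hB (A.inv_mem hA) (B.inv_mem hB),
    key u v _ _ h (A.inv_mem hA) (B.inv_mem hB) hA hB⟩

variable {A B : Subgroup G₀} {β : Type v} {P : PartialSystem β}
  (f : Hom (PartialGroup.ofGroup A).toPartialSystem P)
  (g : Hom (PartialGroup.ofGroup B).toPartialSystem P)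

open scoped Classical in
/-- The function on `A ∪ B` given by functions on `A` and on `B`. -/
noncomputable def unionLiftFun (x : UnionCarrier A B) : β :=
  if h : x.1 ∈ A then f.toFun ⟨x.1, h⟩ else g.toFun ⟨x.1, x.2.resolve_left h⟩

theorem unionLiftFun_inl (x : A) : unionLiftFun f g ((unionInl A B).toFun x) = f.toFun x :=
  dif_pos x.2

theorem unionLiftFun_inr (hfg : ∀ x hA hB, f.toFun ⟨x, hA⟩ = g.toFun ⟨x, hB⟩) (x : B) :
    unionLiftFun f g ((unionInr A B).toFun x) = g.toFun x := by
  unfold unionLiftFun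
  split
  · exact hfg _ _ _
  · rfl

/-- The map on `A ∪ B` given by maps on `A` and on `B` that agree on `A ∩ B`. -/
noncomputable def unionLift (hfg : ∀ x hA hB, f.toFun ⟨x, hA⟩ = g.toFun ⟨x, hB⟩) :
    Hom (unionPartialGroup A B).toPartialSystem P where
  toFun := unionLiftFun f g
  map_isProd w x h := by
    obtain ⟨⟨h0, h⟩, hx⟩ := union_isProd_iff.1 h
    rcases h with h | h
    -- A word with all letters in `A` comes from a word over the group `A`, where `f` already
    -- preserves products.
    · obtain ⟨w, rfl⟩ : ∃ w' : List A, w'.map (unionInl A B).toFun = w := by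
        rw [← Set.mem_range, Set.range_list_map]
        exact fun y hy => ⟨⟨y.1, h y hy⟩, rfl⟩
      have h2 : (PartialGroup.ofGroup A).IsProd w w.prod := ⟨fun h => h0 (by rw [h]; rfl), rfl⟩
      have h3 : x = (unionInl A B).toFun w.prod :=
        (PartialSystem.IsProd.unique ‹_› ((unionInl A B).map_isProd _ _ h2))
      rw [h3, unionLiftFun_inl, List.map_map]
      convert f.map_isProd _ _ h2 using 2
      exact funext (unionLiftFun_inl f g)
    · obtain ⟨w, rfl⟩ : ∃ w' : List B, w'.map (unionInr A B).toFun = w := by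
        rw [← Set.mem_range, Set.range_list_map]
        exact fun y hy => ⟨⟨y.1, h y hy⟩, rfl⟩
      have h2 : (PartialGroup.ofGroup B).IsProd w w.prod := ⟨fun h => h0 (by rw [h]; rfl), rfl⟩
      have h3 : x = (unionInr A B).toFun w.prod :=
        (PartialSystem.IsProd.unique ‹_› ((unionInr A B).map_isProd _ _ h2))
      rw [h3, unionLiftFun_inr f g hfg, List.map_map]
      convert g.map_isProd _ _ h2 using 2
      exact funext (unionLiftFun_inr f g hfg)

theorem PartialSystem.Hom.ext_toFun {α : Type u} {Q : PartialSystem α} {φ ψ : Hom Q P}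
    (h : φ.toFun = ψ.toFun) : φ = ψ := by
  cases φ
  cases ψ
  cases h
  rfl

variable (A B) in
-- A multipliable word of `A ∪ B` never mixes the two subgroups, so two maps that agree on `A ∩ B`
-- glue to a map of partial groups. The glued map is unique since the two inclusions are jointly
-- surjective.
theorem isFiberSum_union :
    IsFiberSum A B ⟨_, unionPartialGroup A B⟩ (unionInl A B) (unionInr A B) := by
  have hcond : ∀ s : Limits.PushoutCocone (C := PartialGrp.{u})
      (X := ⟨_, PartialGroup.ofGroup (A ⊓ B : Subgroup G₀)⟩)
      (Y := ⟨_, PartialGroup.ofGroup A⟩) (Z := ⟨_, PartialGroup.ofGroup B⟩)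
      (PartialGroup.homOfGroupHom (Subgroup.inclusion inf_le_left))
      (PartialGroup.homOfGroupHom (Subgroup.inclusion inf_le_right)),
      ∀ x hA hB, s.inl.toFun ⟨x, hA⟩ = s.inr.toFun ⟨x, hB⟩ := fun s x hA hB =>
    congrFun (congrArg Hom.toFun s.condition) ⟨x, hA, hB⟩
  refine ⟨⟨rfl⟩, ⟨Limits.PushoutCocone.IsColimit.mk _
    (fun s => unionLift s.inl s.inr (hcond s)) (fun s => ?_) (fun s => ?_) (fun s m h1 h2 => ?_)⟩⟩
  · exact Hom.ext_toFun (funext (unionLiftFun_inl _ _))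
  · exact Hom.ext_toFun (funext (unionLiftFun_inr _ _ (hcond s)))
  · refine Hom.ext_toFun (funext ?_)
    rintro ⟨x, hx⟩
    by_cases hA : x ∈ A
    · exact (congrFun (congrArg Hom.toFun h1) ⟨x, hA⟩).trans (unionLiftFun_inl _ _ ⟨x, hA⟩).symm
    · have hB := hx.resolve_left hA
      exact (congrFun (congrArg Hom.toFun h2) ⟨x, hB⟩).trans
        (unionLiftFun_inr _ _ (hcond s) ⟨x, hB⟩).symm

/-- Any fiber sum of `A` and `B` is isomorphic to `A ∪ B`. -/
theorem IsFiberSum.nonempty_iso {A B : Subgroup G₀} {W : PartialGrp.{u}} {jA jB}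
    (h : IsFiberSum A B W jA jB) :
    Nonempty (Iso (unionPartialGroup A B).toPartialSystem W.str.toPartialSystem) := by
  let e := (isFiberSum_union A B).isoIsPushout _ _ h
  exact ⟨{
    toEquiv := {
      toFun := e.hom.toFun
      invFun := e.inv.toFun
      left_inv := congrFun (congrArg Hom.toFun e.hom_inv_id)
      right_inv := congrFun (congrArg Hom.toFun e.inv_hom_id) }
    map_isProd := e.hom.map_isProd
    symm_map_isProd := e.inv.map_isProd }⟩

end FiberSum

/-! ## Two-element sets of figures -/

section Pair

variable {G₀ : Type u} [Group G₀]

theorem C₂.eq_one_or_eq_gen (g : C₂) : g = 1 ∨ g = C₂.gen := by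
  revert g
  decide

theorem C₂.gen_mul_gen : C₂.gen * C₂.gen = 1 := by decide

/-- The transversal `cⁱ ↦ aⁱ`, `i ∈ {0, 1}`. -/
def C₂.lift (a : G₀) (g : C₂) : G₀ := a ^ (Multiplicative.toAdd g).val

theorem C₂.lift_one (a : G₀) : C₂.lift a 1 = 1 := pow_zero a

theorem C₂.lift_gen (a : G₀) : C₂.lift a C₂.gen = a := pow_one a

variable {X₀ : Type v} [MulAction G₀ᵐᵒᵖ X₀] {Fp Fm K : Set X₀} {a u : G₀}

theorem smul_mul_right (K : Set X₀) (g h : G₀) : K <• (g * h) = (K <• g) <• h := by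
  rw [MulOpposite.op_mul, mul_smul]

theorem smul_right_cancel_set (g : G₀) {K L : Set X₀} : K <• g = L <• g ↔ K = L :=
  (MulAction.injective _).eq_iff

theorem mem_symmetryGroup {g : G₀} : g ∈ symmetryGroup G₀ K ↔ K <• g = K := Iff.rfl

/-- The stabilizer of `K t` is the conjugate by `t` of the stabilizer of `K`. -/
theorem conj_mem_symmetryGroup {g t : G₀} :
    t⁻¹ * g * t ∈ symmetryGroup G₀ (K <• t) ↔ g ∈ symmetryGroup G₀ K := by
  rw [mem_symmetryGroup, mem_symmetryGroup, ← smul_mul_right, mul_assoc, mul_inv_cancel_left,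
    smul_mul_right, smul_right_cancel_set]

theorem smul_mem_iff {X : Set (Set X₀)} (hu : u ∈ symmetryGroup G₀ X) : K <• u ∈ X ↔ K ∈ X := by
  conv_lhs => rw [← mem_symmetryGroup.1 hu]
  exact Set.smul_mem_smul_set_iff

theorem mem_or_mem_iff {g : G₀} :
    g ∈ symmetryGroup G₀ Fp ∨ g ∈ symmetryGroup G₀ Fm ↔
      ∃ K ∈ ({Fp, Fm} : Set (Set X₀)), g ∈ symmetryGroup G₀ K := by
  simp

/-- Phrasing multipliability as the existence of a common fixed `K` treats both components alike, so
later arguments can move `K` by powers of `a` without distinguishing cases. -/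
theorem mem_unionDom_iff
    {w : List (UnionCarrier (symmetryGroup G₀ Fp) (symmetryGroup G₀ Fm))} :
    w ∈ unionDom (symmetryGroup G₀ Fp) (symmetryGroup G₀ Fm) ↔
      w ≠ [] ∧ ∃ K ∈ ({Fp, Fm} : Set (Set X₀)), ∀ x ∈ w, x.1 ∈ symmetryGroup G₀ K := by
  simp [unionDom]

theorem conj_mem_or_mem (hu : u ∈ symmetryGroup G₀ ({Fp, Fm} : Set (Set X₀))) {g : G₀}
    (hg : g ∈ symmetryGroup G₀ Fp ∨ g ∈ symmetryGroup G₀ Fm) :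
    u⁻¹ * g * u ∈ symmetryGroup G₀ Fp ∨ u⁻¹ * g * u ∈ symmetryGroup G₀ Fm := by
  obtain ⟨K, hK, h⟩ := mem_or_mem_iff.1 hg
  exact mem_or_mem_iff.2 ⟨K <• u, (smul_mem_iff hu).2 hK, conj_mem_symmetryGroup.2 h⟩

theorem swap_mem_symmetryGroup (hpm : Fp <• a = Fm) (hmp : Fm <• a = Fp) :
    a ∈ symmetryGroup G₀ ({Fp, Fm} : Set (Set X₀)) := by
  rw [mem_symmetryGroup]
  change (fun K : Set X₀ => K <• a) '' {Fp, Fm} = {Fp, Fm}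
  rw [Set.image_pair, hpm, hmp, Set.pair_comm]

theorem lift_mem_symmetryGroup (hpm : Fp <• a = Fm) (hmp : Fm <• a = Fp) (g : C₂) :
    C₂.lift a g ∈ symmetryGroup G₀ ({Fp, Fm} : Set (Set X₀)) :=
  Subgroup.pow_mem _ (swap_mem_symmetryGroup hpm hmp) _

/-- By injectivity, an element that fixes one of two sets cannot carry the other one onto it; if the
image still lies in the pair, the other set is fixed as well. This turns membership in a parade into
a stabilizer condition. -/
theorem smul_mem_pair_iff (hne : Fp ≠ Fm) {g : G₀}
    (hg : g ∈ symmetryGroup G₀ Fp ∨ g ∈ symmetryGroup G₀ Fm)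
    (hK : K ∈ ({Fp, Fm} : Set (Set X₀))) :
    K <• g ∈ ({Fp, Fm} : Set (Set X₀)) ↔ K <• g = K := by
  refine ⟨fun h => ?_, fun h => by rwa [h]⟩
  simp only [mem_symmetryGroup] at hg
  rcases hg with hg | hg <;> rcases hK with rfl | hK
  · exact hg
  · obtain rfl : K = Fm := hK
    rcases h with h | h
    · exact absurd ((smul_right_cancel_set g).1 (hg.trans h.symm)) hne
    · exact h
  · rcases h with h | h
    · exact h
    · exact absurd ((smul_right_cancel_set g).1 (h.trans hg.symm)) hne
  · obtain rfl : K = Fm := hK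
    exact hg

theorem smul_swap_ne (hne : Fp ≠ Fm) (hpm : Fp <• a = Fm) (hmp : Fm <• a = Fp)
    (hK : K ∈ ({Fp, Fm} : Set (Set X₀))) : K <• a ≠ K := by
  rcases hK with rfl | hK
  · rw [hpm]
    exact hne.symm
  · obtain rfl : K = Fm := hK
    rw [hmp]
    exact hne

theorem exists_smul_lift_eq (hpm : Fp <• a = Fm) (hmp : Fm <• a = Fp) {L : Set X₀}
    (hK : K ∈ ({Fp, Fm} : Set (Set X₀))) (hL : L ∈ ({Fp, Fm} : Set (Set X₀))) :
    ∃ g : C₂, K <• C₂.lift a g = L := by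
  have h1 : ∀ K : Set X₀, K <• C₂.lift a 1 = K := by simp [C₂.lift_one]
  rcases hK with rfl | rfl <;> rcases hL with rfl | rfl
  · exact ⟨1, h1 _⟩
  · exact ⟨C₂.gen, by rw [C₂.lift_gen, hpm]⟩
  · exact ⟨C₂.gen, by rw [C₂.lift_gen, hmp]⟩
  · exact ⟨1, h1 _⟩

/-- The obstruction `aⁱ⁺ʲ ↦ a^{-(i+j)} aⁱ aʲ` of the transversal to being a homomorphism. -/
def C₂.defect (a : G₀) (g h : C₂) : G₀ := (C₂.lift a (g * h))⁻¹ * C₂.lift a g * C₂.lift a h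

theorem C₂.defect_gen (a : G₀) : C₂.defect a C₂.gen C₂.gen = a ^ 2 := by
  simp [C₂.defect, C₂.gen_mul_gen, C₂.lift_one, C₂.lift_gen, pow_two]

theorem C₂.defect_one_left (a : G₀) (g : C₂) : C₂.defect a 1 g = 1 := by
  simp [C₂.defect, C₂.lift_one]

theorem C₂.defect_one_right (a : G₀) (g : C₂) : C₂.defect a g 1 = 1 := by
  simp [C₂.defect, C₂.lift_one]

/-- The only nontrivial value is `a ^ 2`, and swapping twice fixes both sets. -/
theorem defect_mem (hpm : Fp <• a = Fm) (hmp : Fm <• a = Fp) (g h : C₂) :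
    C₂.defect a g h ∈ symmetryGroup G₀ Fp ∧ C₂.defect a g h ∈ symmetryGroup G₀ Fm := by
  rcases C₂.eq_one_or_eq_gen g with rfl | rfl
  · rw [C₂.defect_one_left]
    exact ⟨one_mem _, one_mem _⟩
  rcases C₂.eq_one_or_eq_gen h with rfl | rfl
  · rw [C₂.defect_one_right]
    exact ⟨one_mem _, one_mem _⟩
  · rw [C₂.defect_gen, pow_two, mem_symmetryGroup, mem_symmetryGroup, smul_mul_right,
      smul_mul_right, hpm, hmp]
    exact ⟨rfl, hpm⟩

/-- Conjugation by `aⁱ` on `G(F₊) ∪ G(F₋)`. -/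
def swapAct (hpm : Fp <• a = Fm) (hmp : Fm <• a = Fp)
    (x : UnionCarrier (symmetryGroup G₀ Fp) (symmetryGroup G₀ Fm)) (g : C₂) :
    UnionCarrier (symmetryGroup G₀ Fp) (symmetryGroup G₀ Fm) :=
  ⟨(C₂.lift a g)⁻¹ * x.1 * C₂.lift a g, conj_mem_or_mem (lift_mem_symmetryGroup hpm hmp g) x.2⟩

theorem swapAct_one (hpm : Fp <• a = Fm) (hmp : Fm <• a = Fp) (x) : swapAct hpm hmp x 1 = x :=
  Subtype.ext (by simp [swapAct, C₂.lift_one])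

theorem prod_map_conj (u : G₀) (w : List G₀) :
    (w.map fun x => u⁻¹ * x * u).prod = u⁻¹ * w.prod * u := by
  induction w with
  | nil => simp
  | cons x w ih =>
    rw [List.map_cons, List.prod_cons, ih, List.prod_cons]
    group

theorem swapAct_isProd (hpm : Fp <• a = Fm) (hmp : Fm <• a = Fp)
    (g : C₂) (w x) (h : (unionPartialGroup _ _).IsProd w x) :
    (unionPartialGroup _ _).IsProd (w.map (swapAct hpm hmp · g)) (swapAct hpm hmp x g) := by
  rw [union_isProd_iff, mem_unionDom_iff] at h ⊢
  obtain ⟨⟨h0, K, hK, h⟩, hx⟩ := h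
  refine ⟨⟨by simpa using h0, K <• C₂.lift a g,
    (smul_mem_iff (lift_mem_symmetryGroup hpm hmp g)).2 hK, ?_⟩, ?_⟩
  · intro y hy
    obtain ⟨z, hz, rfl⟩ := List.mem_map.1 hy
    exact conj_mem_symmetryGroup.2 (h z hz)
  · change _ = (C₂.lift a g)⁻¹ * x.1 * C₂.lift a g
    rw [← hx, ← prod_map_conj, List.map_map, List.map_map]
    rfl

/-- `σ(cⁱ, cʲ)` as an element of the normalizer. -/
def swapDefect (hpm : Fp <• a = Fm) (hmp : Fm <• a = Fp) (g h : C₂) :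
    (unionPartialGroup (symmetryGroup G₀ Fp) (symmetryGroup G₀ Fm)).Normalizer :=
  ⟨⟨C₂.defect a g h, Or.inl (defect_mem hpm hmp g h).1⟩,
    union_isNormal (defect_mem hpm hmp g h).1 (defect_mem hpm hmp g h).2⟩

theorem normalizer_union_mul {A B : Subgroup G₀} (g h : (unionPartialGroup A B).Normalizer) :
    (g * h).1.1 = g.1.1 * h.1.1 := by
  change ([g.1, h.1].map Subtype.val).prod = _
  simp

/-- The factor set for `(G(F₊) ∪ G(F₋), C₂)` given by an element that swaps `F₊` and `F₋`. -/
def swapFactorSet (hpm : Fp <• a = Fm) (hmp : Fm <• a = Fp) :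
    FactorSet (unionPartialGroup (symmetryGroup G₀ Fp) (symmetryGroup G₀ Fm)) C₂ where
  act := swapAct hpm hmp
  σ := swapDefect hpm hmp
  act_one := swapAct_one hpm hmp
  σ_one_left g := Subtype.ext (Subtype.ext (C₂.defect_one_left a g))
  σ_one_right g := Subtype.ext (Subtype.ext (C₂.defect_one_right a g))
  act_isProd := swapAct_isProd hpm hmp
  act_act x g h := by
    obtain ⟨h1, h2⟩ := defect_mem hpm hmp g h
    rw [union_isProd_iff]
    constructor
    -- The outer letters lie in both subgroups, so the middle letter decides which subgroup contains
    -- the word.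
    · refine ⟨by simp, (swapAct hpm hmp x (g * h)).2.imp (fun k => ?_) (fun k => ?_)⟩
      · simpa using ⟨inv_mem h1, k, h1⟩
      · simpa using ⟨inv_mem h2, k, h2⟩
    · change ([(C₂.defect a g h)⁻¹, (C₂.lift a (g * h))⁻¹ * x.1 * C₂.lift a (g * h),
        C₂.defect a g h]).prod =
        (C₂.lift a h)⁻¹ * ((C₂.lift a g)⁻¹ * x.1 * C₂.lift a g) * C₂.lift a h
      simp only [C₂.defect, List.prod_cons, List.prod_nil]
      group
  cocycle g h k := by
    obtain ⟨h1, -⟩ := defect_mem hpm hmp g h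
    obtain ⟨h3, h4⟩ := defect_mem hpm hmp (g * h) k
    rw [union_isProd_iff, normalizer_union_mul]
    constructor
    · refine ⟨by simp, (swapAct hpm hmp (swapDefect hpm hmp g h).1 k).2.imp
        (fun k => ?_) (fun k => ?_)⟩
      · simpa using ⟨h3, k⟩
      · simpa using ⟨h4, k⟩
    · change ([C₂.defect a (g * h) k, (C₂.lift a k)⁻¹ * C₂.defect a g h * C₂.lift a k]).prod =
        C₂.defect a g (h * k) * C₂.defect a h k
      -- Reassociating in `C₂` makes the two spellings of the lift of `ghk` the same atom; what
      -- remains is an identity valid in every group.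
      simp only [C₂.defect, List.prod_cons, List.prod_nil, mul_assoc g h k]
      group

/-- For an involution that swaps `F₊` and `F₋`, conjugation is an action of `C₂` on
`G(F₊) ∪ G(F₋)`. -/
def swapGPartialGroup (hpm : Fp <• a = Fm) (hmp : Fm <• a = Fp)
    (ha : a ^ 2 = 1) :
    GPartialGroup (unionPartialGroup (symmetryGroup G₀ Fp) (symmetryGroup G₀ Fm)) C₂ where
  act := swapAct hpm hmp
  act_one := swapAct_one hpm hmp
  act_isProd := swapAct_isProd hpm hmp
  act_act x g h := by
    -- When `a ^ 2 = 1` the transversal is a homomorphism, so conjugation by it is a genuine action.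
    have hl : C₂.lift a (g * h) = C₂.lift a g * C₂.lift a h := by
      rcases C₂.eq_one_or_eq_gen g with rfl | rfl
      · simp [C₂.lift_one]
      rcases C₂.eq_one_or_eq_gen h with rfl | rfl
      · simp [C₂.lift_one]
      · rw [C₂.gen_mul_gen, C₂.lift_one, C₂.lift_gen, ← pow_two, ha]
    refine Subtype.ext ?_
    simp only [swapAct, hl]
    group

/-! ## The isomorphism with the partial group of parades -/

variable {τ : FactorSet (unionPartialGroup (symmetryGroup G₀ Fp) (symmetryGroup G₀ Fm)) C₂}

theorem foldl_act_val
    (hact : ∀ x g, (τ.act x g).1 = (C₂.lift a g)⁻¹ * x.1 * C₂.lift a g) (l : List C₂) (x) :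
    (l.foldl τ.act x).1 = (l.map (C₂.lift a)).prod⁻¹ * x.1 * (l.map (C₂.lift a)).prod := by
  induction l generalizing x with
  | nil => simp
  | cons g l ih =>
    rw [List.foldl_cons, ih, hact, List.map_cons, List.prod_cons]
    group

/-- Each factor `σ(cᵢ, cᵢ₊₁⋯cₙ)` replaces the lift of `cᵢ⋯cₙ` by the lift of `cᵢ` times the lift of
`cᵢ₊₁⋯cₙ`, so the product telescopes. -/
theorem lift_prod_mul_σList (hσ : ∀ g h, (τ.σ g h).1.1 = C₂.defect a g h) (l : List C₂) :
    C₂.lift a l.prod * (τ.σList l).1.1 = (l.map (C₂.lift a)).prod := by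
  induction l with
  | nil =>
    rw [List.prod_nil, C₂.lift_one, one_mul]
    rfl
  | cons g l ih =>
    rw [List.map_cons, List.prod_cons, List.prod_cons, ← ih, FactorSet.σList,
      normalizer_union_mul, hσ, C₂.defect]
    group

/-- Collects all powers of `a` on the left; passing them across `ηᵢ` conjugates it by the later
powers, which is what `twist` records. -/
theorem prod_lift_mul
    (hact : ∀ x g, (τ.act x g).1 = (C₂.lift a g)⁻¹ * x.1 * C₂.lift a g) (w : List (C₂ × _)) :
    (w.map fun p => C₂.lift a p.1 * p.2.1).prod =
      ((w.map Prod.fst).map (C₂.lift a)).prod * ((τ.twist w).map Subtype.val).prod := by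
  induction w with
  | nil => simp [FactorSet.twist]
  | cons p w ih =>
    simp only [FactorSet.twist, List.map_cons, List.prod_cons, ih, foldl_act_val hact]
    group

/-- Along a parade each `ηᵢ` must fix the set reached just before it, so the sets visited are those
reached by the powers of `a` alone. Conjugation by the later powers moves each of these conditions
to the common endpoint. -/
theorem isRoute_iff_twist (hpm : Fp <• a = Fm) (hmp : Fm <• a = Fp) (hne : Fp ≠ Fm)
    (hact : ∀ x g, (τ.act x g).1 = (C₂.lift a g)⁻¹ * x.1 * C₂.lift a g) (w : List (C₂ × _))
    (hK : K ∈ ({Fp, Fm} : Set (Set X₀))) :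
    IsRoute {Fp, Fm} K (w.map fun p => C₂.lift a p.1 * p.2.1) ↔
      ∀ x ∈ τ.twist w,
        x.1 ∈ symmetryGroup G₀ (K <• ((w.map Prod.fst).map (C₂.lift a)).prod) := by
  induction w generalizing K with
  | nil => simpa [IsRoute, FactorSet.twist] using hK
  | cons p w ih =>
    have hL : K <• C₂.lift a p.1 ∈ ({Fp, Fm} : Set (Set X₀)) :=
      (smul_mem_iff (lift_mem_symmetryGroup hpm hmp p.1)).2 hK
    simp only [List.map_cons, FactorSet.twist, List.forall_mem_cons, List.prod_cons, IsRoute, hK,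
      true_and, foldl_act_val hact]
    -- Undoing the conjugation for the first letter leaves the condition that `η₁` fixes `K u₁`; the
    -- conditions on the other letters describe a parade starting at `K u₁`.
    rw [smul_mul_right, smul_mul_right, conj_mem_symmetryGroup, mem_symmetryGroup, ← ih hL]
    constructor
    · intro h
      have h1 := (smul_mem_pair_iff hne p.2.2 hL).1 h.start_mem
      exact ⟨h1, h1 ▸ h⟩
    · rintro ⟨h1, h⟩
      rwa [h1]

variable {X : Set (Set X₀)}

/-- The map `(cⁱ, η) ↦ aⁱ η`. -/
def swapFun (hpm : Fp <• a = Fm) (hmp : Fm <• a = Fp) (hX : X = {Fp, Fm})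
    (p : C₂ × UnionCarrier (symmetryGroup G₀ Fp) (symmetryGroup G₀ Fm)) : ParadeCarrier G₀ X :=
  ⟨C₂.lift a p.1 * p.2.1, by
    obtain ⟨K, hK, h⟩ := mem_or_mem_iff.1 p.2.2
    have hu := inv_mem (lift_mem_symmetryGroup hpm hmp p.1)
    refine ⟨K <• (C₂.lift a p.1)⁻¹, ?_, ?_⟩
    · rw [hX, smul_mem_iff hu]
      exact hK
    · change (K <• (C₂.lift a p.1)⁻¹) <• (C₂.lift a p.1 * p.2.1) ∈ X
      rw [← smul_mul_right, inv_mul_cancel_left, mem_symmetryGroup.1 h, hX]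
      exact hK⟩

/-- Let `y` fix `K` and suppose `x = a y`. Then `x` carries `K a⁻¹` to `K`, hence fixes `K a⁻¹`, so
that `K a⁻¹ = K`. But `a` fixes neither set. -/
theorem lift_mul_ne (hpm : Fp <• a = Fm) (hmp : Fm <• a = Fp) (hne : Fp ≠ Fm)
    (x y : UnionCarrier (symmetryGroup G₀ Fp) (symmetryGroup G₀ Fm)) : x.1 ≠ a * y.1 := by
  intro h
  obtain ⟨K, hK, hy⟩ := mem_or_mem_iff.1 y.2
  have hM := (smul_mem_iff (inv_mem (swap_mem_symmetryGroup hpm hmp))).2 hK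
  have h1 : (K <• a⁻¹) <• x.1 = K := by
    rw [h, ← smul_mul_right, inv_mul_cancel_left, mem_symmetryGroup.1 hy]
  have h2 := (smul_mem_pair_iff hne x.2 hM).1 (by rwa [h1])
  refine smul_swap_ne hne hpm hmp hM ?_
  rw [← smul_mul_right, inv_mul_cancel, MulOpposite.op_one, one_smul, ← h2, h1]

theorem swapFun_bijective (hpm : Fp <• a = Fm) (hmp : Fm <• a = Fp)
    (hne : Fp ≠ Fm) (hX : X = {Fp, Fm}) :
    Function.Bijective (swapFun hpm hmp hX) := by
  constructor
  · rintro ⟨g, x⟩ ⟨h, y⟩ e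
    have e' : C₂.lift a g * x.1 = C₂.lift a h * y.1 := congrArg Subtype.val e
    rcases C₂.eq_one_or_eq_gen g with rfl | rfl <;> rcases C₂.eq_one_or_eq_gen h with rfl | rfl
    · rw [Subtype.ext (mul_left_cancel e')]
    · rw [C₂.lift_one, C₂.lift_gen, one_mul] at e'
      exact absurd e' (lift_mul_ne hpm hmp hne x y)
    · rw [C₂.lift_one, C₂.lift_gen, one_mul] at e'
      exact absurd e'.symm (lift_mul_ne hpm hmp hne y x)
    · rw [Subtype.ext (mul_left_cancel e')]
  · rintro ⟨g, K, hK, hL⟩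
    replace hL : K <• g ∈ X := hL
    rw [hX] at hK hL
    obtain ⟨i, hi⟩ := exists_smul_lift_eq hpm hmp hK hL
    -- With `K aⁱ = L = K g`, the element `a⁻ⁱ g` sends `L` back to `K` and then to `L`.
    refine ⟨⟨i, (C₂.lift a i)⁻¹ * g, mem_or_mem_iff.2 ⟨_, hL, ?_⟩⟩,
      Subtype.ext (mul_inv_cancel_left _ _)⟩
    rw [mem_symmetryGroup]
    conv_lhs => rw [← hi]
    rw [← smul_mul_right, mul_inv_cancel_left]

theorem mem_extension_dom_iff (hpm : Fp <• a = Fm) (hmp : Fm <• a = Fp) (hne : Fp ≠ Fm)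
    (hact : ∀ x g, (τ.act x g).1 = (C₂.lift a g)⁻¹ * x.1 * C₂.lift a g) (w : List (C₂ × _)) :
    τ.twist w ∈ unionDom (symmetryGroup G₀ Fp) (symmetryGroup G₀ Fm) ↔
      w ≠ [] ∧ ∃ K, IsRoute {Fp, Fm} K (w.map fun p => C₂.lift a p.1 * p.2.1) := by
  have hnil : τ.twist w = [] ↔ w = [] := by cases w <;> simp [FactorSet.twist]
  rw [mem_unionDom_iff, Ne, hnil]
  refine and_congr_right fun _ => ?_
  have hu : ((w.map Prod.fst).map (C₂.lift a)).prod ∈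
      symmetryGroup G₀ ({Fp, Fm} : Set (Set X₀)) := by
    refine Subgroup.list_prod_mem _ fun x hx => ?_
    obtain ⟨g, -, rfl⟩ := List.mem_map.1 hx
    exact lift_mem_symmetryGroup hpm hmp g
  constructor
  · rintro ⟨K, hK, h⟩
    -- The set fixed by the twisted letters is the endpoint of the parade, so the starting point is
    -- its translate by the inverse of the product of all powers of `a`.
    refine ⟨_, (isRoute_iff_twist hpm hmp hne hact w ((smul_mem_iff (inv_mem hu)).2 hK)).2 ?_⟩
    rwa [← smul_mul_right, inv_mul_cancel, MulOpposite.op_one, one_smul]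
  · rintro ⟨K, h⟩
    exact ⟨_, (smul_mem_iff hu).2 h.start_mem,
      (isRoute_iff_twist hpm hmp hne hact w h.start_mem).1 h⟩

/-- The map `(cⁱ, η) ↦ aⁱ η` is an isomorphism from the extension of `G(F₊) ∪ G(F₋)` by `C₂` onto
the partial group of parades in `{F₊, F₋}`. -/
noncomputable def swapIso (hpm : Fp <• a = Fm) (hmp : Fm <• a = Fp)
    (hne : Fp ≠ Fm) (hX : X = {Fp, Fm}) (hX' : X.Nonempty)
    (hact : ∀ x g, (τ.act x g).1 = (C₂.lift a g)⁻¹ * x.1 * C₂.lift a g)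
    (hσ : ∀ g h, (τ.σ g h).1.1 = C₂.defect a g h) :
    Iso τ.extension (paradePartialGroup G₀ X hX').toPartialSystem :=
  Iso.ofIsProdIff (Equiv.ofBijective _ (swapFun_bijective hpm hmp hne hX)) fun w x => by
    have hw : (w.map (swapFun hpm hmp hX)).map Subtype.val =
        w.map fun p => C₂.lift a p.1 * p.2.1 := by
      rw [List.map_map]
      rfl
    have hdom : w.map (swapFun hpm hmp hX) ∈ (paradePartialGroup G₀ X hX').dom ↔
        w ∈ τ.extension.dom := by
      refine Iff.trans ?_ (mem_extension_dom_iff hpm hmp hne hact w).symm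
      change (w.map (swapFun hpm hmp hX) ≠ [] ∧
        ∃ K, IsRoute X K ((w.map (swapFun hpm hmp hX)).map Subtype.val)) ↔ _
      rw [hw, Ne, List.map_eq_nil_iff, hX]
    have hprod : ∀ h : w ∈ τ.extension.dom,
        (swapFun hpm hmp hX (τ.extension.prod w h)).1 =
          ((w.map (swapFun hpm hmp hX)).map Subtype.val).prod := by
      intro h
      -- Both sides become the lift of `c₁⋯cₙ`, times `σ(c₁,…,cₙ)`, times the product of the twisted
      -- letters.
      rw [hw, prod_lift_mul hact, ← lift_prod_mul_σList hσ, mul_assoc]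
      rfl
    rw [Equiv.coe_ofBijective]
    constructor
    · rintro ⟨h, rfl⟩
      exact ⟨hdom.2 h, Subtype.ext (hprod h).symm⟩
    · rintro ⟨h, e⟩
      have h' := hdom.1 h
      refine ⟨h', (swapFun_bijective hpm hmp hne hX).1 (Subtype.ext ?_)⟩
      rw [hprod h', ← e]
      rfl

/-- The structure of the partial group of parades in two sets that are swapped by some group
element. -/
theorem parade_pair_structure (hpm : Fp <• a = Fm) (hmp : Fm <• a = Fp)
    (hne : Fp ≠ Fm) (hX : X = {Fp, Fm}) (hX' : X.Nonempty) :
    (∀ (W : PartialGrp.{u}) jp jm,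
      IsFiberSum (symmetryGroup G₀ Fp) (symmetryGroup G₀ Fm) W jp jm →
      ∃ τ : FactorSet W.str C₂, τ.extension.IsPartialGroup ∧
        Nonempty (Iso (paradePartialGroup G₀ X hX').toPartialSystem τ.extension)) ∧
    IsFiberSum (symmetryGroup G₀ Fp) (symmetryGroup G₀ Fm)
      ⟨_, unionPartialGroup (symmetryGroup G₀ Fp) (symmetryGroup G₀ Fm)⟩
      (unionInl _ _) (unionInr _ _) ∧
    (∃ τ : FactorSet (unionPartialGroup (symmetryGroup G₀ Fp) (symmetryGroup G₀ Fm)) C₂,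
      (∀ η, (τ.act η C₂.gen).1 = a⁻¹ * η.1 * a) ∧
      (τ.σ C₂.gen C₂.gen).1.1 = a ^ 2 ∧
      τ.extension.IsPartialGroup ∧
      ∃ ψ : Iso τ.extension (paradePartialGroup G₀ X hX').toPartialSystem,
        ∀ i ∈ ({0, 1} : Set ℕ), ∀ η, (ψ.toEquiv (C₂.gen ^ i, η)).1 = a ^ i * η.1) ∧
    (a ^ 2 = 1 → ∃ ρ : GPartialGroup
        (unionPartialGroup (symmetryGroup G₀ Fp) (symmetryGroup G₀ Fm)) C₂,
      (∀ η, (ρ.act η C₂.gen).1 = a⁻¹ * η.1 * a) ∧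
      ρ.semidirect.IsPartialGroup ∧
      Nonempty (Iso (paradePartialGroup G₀ X hX').toPartialSystem ρ.semidirect)) := by
  have hgen : ∀ η, (swapAct hpm hmp η C₂.gen).1 = a⁻¹ * η.1 * a := fun η => by
    simp only [swapAct, C₂.lift_gen]
  let ψ : Iso (swapFactorSet hpm hmp).extension (paradePartialGroup G₀ X hX').toPartialSystem :=
    swapIso hpm hmp hne hX hX' (fun _ _ => rfl) (fun _ _ => rfl)
  refine ⟨fun W jp jm hW => ?_, isFiberSum_union _ _,
    ⟨swapFactorSet hpm hmp, hgen, C₂.defect_gen a, ψ.isPartialGroup, ψ, ?_⟩, fun ha => ?_⟩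
  · obtain ⟨e⟩ := hW.nonempty_iso
    -- An arbitrary pushout `W` is isomorphic to the union, and the factor set moves to `W` along
    -- that isomorphism.
    let φ := ((swapFactorSet hpm hmp).transportIso e).symm.trans ψ
    exact ⟨_, φ.isPartialGroup, ⟨φ.symm⟩⟩
  · intro i hi η
    change C₂.lift a (C₂.gen ^ i) * η.1 = a ^ i * η.1
    rcases hi with rfl | rfl
    · rw [pow_zero, pow_zero, C₂.lift_one]
    · rw [pow_one, pow_one, C₂.lift_gen]
  -- For `a ^ 2 = 1` the defect vanishes, so the factor set with `σ ≡ 1` meets the hypotheses of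
  -- `swapIso`.
  · have hσ : ∀ g h : C₂, C₂.defect a g h = 1 := fun g h => by
      rcases C₂.eq_one_or_eq_gen g with rfl | rfl
      · exact C₂.defect_one_left a h
      rcases C₂.eq_one_or_eq_gen h with rfl | rfl
      · exact C₂.defect_one_right a _
      · rw [C₂.defect_gen, ha]
    let φ : Iso (swapGPartialGroup hpm hmp ha).semidirect
        (paradePartialGroup G₀ X hX').toPartialSystem :=
      swapIso hpm hmp hne hX hX' (fun _ _ => rfl) (fun g h => (hσ g h).symm)
    exact ⟨swapGPartialGroup hpm hmp ha, hgen, φ.isPartialGroup, ⟨φ.symm⟩⟩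

end Pair

/-! ### Figures with two connected components -/

theorem theorem8p5 (d : ℕ) (F Fp Fm : Set (Euc d)) (hF : F.Nonempty)
    (hcc : cc F = {Fp, Fm}) (hne : Fp ≠ Fm)
    (a : EGroup d) (hpm : Fp <• a = Fm) (hmp : Fm <• a = Fp) :
    -- `𝒫(F) ≅ C₂ ⋉_{↼,σ} W` for the fiber sum `W` of `G(F₊)` and `G(F₋)` and some `(↼,σ)`
    (∀ (W : PartialGrp.{0}) jp jm, IsFiberSum (symG Fp) (symG Fm) W jp jm →
      ∃ τ : FactorSet W.str C₂, τ.extension.IsPartialGroup ∧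
        Nonempty (PartialSystem.Iso (symP F hF).toPartialSystem τ.extension)) ∧
    -- the fiber sum is identified with `ℋ = G(F₊) ∪ G(F₋)`
    IsFiberSum (symG Fp) (symG Fm) ⟨_, unionPartialGroup (symG Fp) (symG Fm)⟩
      (unionInl _ _) (unionInr _ _) ∧
    -- the explicit factor set and the explicit isomorphism
    (∃ τ : FactorSet (unionPartialGroup (symG Fp) (symG Fm)) C₂,
      (∀ η, (τ.act η C₂.gen).1 = a⁻¹ * η.1 * a) ∧
      (τ.σ C₂.gen C₂.gen).1.1 = a ^ 2 ∧
      τ.extension.IsPartialGroup ∧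
      ∃ ψ : PartialSystem.Iso τ.extension (symP F hF).toPartialSystem,
        ∀ i ∈ ({0, 1} : Set ℕ), ∀ η, (ψ.toEquiv (C₂.gen ^ i, η)).1 = a ^ i * η.1) ∧
    -- the case `a² = 1`
    (a ^ 2 = 1 → ∃ ρ : GPartialGroup (unionPartialGroup (symG Fp) (symG Fm)) C₂,
      (∀ η, (ρ.act η C₂.gen).1 = a⁻¹ * η.1 * a) ∧
      ρ.semidirect.IsPartialGroup ∧
      Nonempty (PartialSystem.Iso (symP F hF).toPartialSystem ρ.semidirect)) ∧
    -- the analogous statements for `S𝒫(F)` when `a ∈ M(d)`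
    (∀ ha : a ∈ MGroup d,
      (∀ (W : PartialGrp.{0}) jp jm, IsFiberSum (symSG Fp) (symSG Fm) W jp jm →
        ∃ τ : FactorSet W.str C₂, τ.extension.IsPartialGroup ∧
          Nonempty (PartialSystem.Iso (symSP F hF).toPartialSystem τ.extension)) ∧
      IsFiberSum (symSG Fp) (symSG Fm) ⟨_, unionPartialGroup (symSG Fp) (symSG Fm)⟩
        (unionInl _ _) (unionInr _ _) ∧
      (∃ τ : FactorSet (unionPartialGroup (symSG Fp) (symSG Fm)) C₂,
        (∀ η, (τ.act η C₂.gen).1 = (⟨a, ha⟩ : MGroup d)⁻¹ * η.1 * ⟨a, ha⟩) ∧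
        (τ.σ C₂.gen C₂.gen).1.1 = (⟨a, ha⟩ : MGroup d) ^ 2 ∧
        τ.extension.IsPartialGroup ∧
        ∃ ψ : PartialSystem.Iso τ.extension (symSP F hF).toPartialSystem,
          ∀ i ∈ ({0, 1} : Set ℕ), ∀ η,
            (ψ.toEquiv (C₂.gen ^ i, η)).1 = (⟨a, ha⟩ : MGroup d) ^ i * η.1) ∧
      (a ^ 2 = 1 → ∃ ρ : GPartialGroup (unionPartialGroup (symSG Fp) (symSG Fm)) C₂,
        (∀ η, (ρ.act η C₂.gen).1 = (⟨a, ha⟩ : MGroup d)⁻¹ * η.1 * ⟨a, ha⟩) ∧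
        ρ.semidirect.IsPartialGroup ∧
        Nonempty (PartialSystem.Iso (symSP F hF).toPartialSystem ρ.semidirect))) := by
  have key := parade_pair_structure hpm hmp hne hcc (cc_nonempty hF)
  refine ⟨key.1, key.2.1, key.2.2.1, key.2.2.2, fun ha => ?_⟩
  -- The action of `M(d)` is the restriction of that of `E(d)`, so the swapping relations hold by
  -- definition and the general result applies again.
  have hpm' : Fp <• (⟨a, ha⟩ : MGroup d) = Fm := hpm
  have hmp' : Fm <• (⟨a, ha⟩ : MGroup d) = Fp := hmp
  have key' := parade_pair_structure hpm' hmp' hne hcc (cc_nonempty hF)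
  exact ⟨key'.1, key'.2.1, key'.2.2.1, fun h => key'.2.2.2 (Subtype.ext h)⟩
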